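/- Let $n,k$ be positive integers and let $\mathfrak S_n$ be the set of permutations $\sigma=a_1a_2\cdots a_n$ of $[n]=\{1,\dots,n\}$. For a statistic $\mathrm{st}:\mathfrak S_n\to\mathbb N$ put $F_n^{\mathrm{st}}(q)=\sum_{\sigma\in\mathfrak S_n}q^{\mathrm{st}(\sigma)}$. Define $$\mathrm{Des}_k(\sigma)=\{i : 1\le i,\ i+k\le n,\ a_i>a_{i+k}\},\qquad \mathrm{des}_k(\sigma)=|\mathrm{Des}_k(\sigma)|,$$ $$\mathrm{inv}_k(\sigma)=\bigl|\{(i,j)\in[n]^2 : a_i>a_j,\ j-i=mk\text{ for some integer }m\ge 1\}\bigr|,\qquad \mathrm{maj}_k(\sigma)=\sum_{i\in\mathrm{Des}_k(\sigma)}\left\lceil \frac ik\right\rceil .$$ For $1\le i\le k$ let $\beta^i_{n,k}(\sigma)=a_ia_{i+k}a_{i+2k}\cdots$ be the (possibly empty) word of the letters of $\sigma$ in the positions in $[n]$ congruent to $i$ modulo $k$, and let $\mathrm{std}$ denote standardization (replace the smallest letter of a word by $1$, the second smallest by $2$, and so on). For a permutation $\tau=b_1\cdots b_m$ let $\mathrm{Exc}(\tau)=\{j\in[m]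 : b_j>j\}$. Let $\mathrm{Exc}_k(\sigma)$ be the multiset union (with multiplicities added) of the sets $\mathrm{Exc}(\mathrm{std}\,\beta^i_{n,k}(\sigma))$, $1\le i\le k$, and let $\mathrm{exc}_k(\sigma)=|\mathrm{Exc}_k(\sigma)|=\sum_{i=1}^k|\mathrm{Exc}(\mathrm{std}\,\beta^i_{n,k}(\sigma))|$. Then $$F_n^{\mathrm{des}_k}(q)=F_n^{\mathrm{exc}_k}(q)\qquad\text{and}\qquad F_n^{\mathrm{inv}_k}(q)=F_n^{\mathrm{maj}_k}(q).$$ That is, over $\mathfrak S_n$, $\mathrm{exc}_k$ is equidistributed with $\mathrm{des}_k$, and $\mathrm{maj}_k$ is equidistributed with $\mathrm{inv}_k$. -/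

import Mathlib

/-! Permutations `σ = a₁ a₂ ⋯ aₙ` of `[n] = {1, …, n}` are elements of `Equiv.Perm (Fin n)`.
Positions and letters are shifted by one: the position `i : Fin n` stands for `i + 1 ∈ [n]`, and
`σ i : Fin n` stands for the letter `a_{i+1} - 1`. -/

namespace WidthStat

open Polynomial

/-- The generating function `F_n^st(q) = ∑_{σ ∈ S_n} q^{st σ}` of a permutation statistic. -/
noncomputable def genFun (n : ℕ) (st : Equiv.Perm (Fin n) → ℕ) : ℤ[X] :=
  ∑ σ : Equiv.Perm (Fin n), X ^ st σ

/-- The set of width-`k` descents: the positions `i` with `i + k` still a position and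
`a_i > a_{i+k}`. -/
def desSet {n : ℕ} (k : ℕ) (σ : Equiv.Perm (Fin n)) : Finset (Fin n) :=
  {i | ∃ h : (i : ℕ) + k < n, σ ⟨(i : ℕ) + k, h⟩ < σ i}

/-- The number of width-`k` descents. -/
def des {n : ℕ} (k : ℕ) (σ : Equiv.Perm (Fin n)) : ℕ := (desSet k σ).card

/-- The set of width-`k` inversions: the pairs `(i, j)` of positions with `a_i > a_j` such that
`j - i` is a positive multiple of `k`. -/
def invSet {n : ℕ} (k : ℕ) (σ : Equiv.Perm (Fin n)) : Finset (Fin n × Fin n) :=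
  {p | p.1 < p.2 ∧ k ∣ (p.2 : ℕ) - (p.1 : ℕ) ∧ σ p.2 < σ p.1}

/-- The number of width-`k` inversions. -/
def inv {n : ℕ} (k : ℕ) (σ : Equiv.Perm (Fin n)) : ℕ := (invSet k σ).card

/-- The width-`k` major index `∑ ⌈i / k⌉`, over the width-`k` descents `i ∈ [n]`
(the element `i : Fin n` stands for `i + 1`; `⌈/⌉` is division rounded up). -/
def maj {n : ℕ} (k : ℕ) (σ : Equiv.Perm (Fin n)) : ℕ :=
  ∑ i ∈ desSet k σ, ((i : ℕ) + 1) ⌈/⌉ k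

/-- The set of (classical) excedances `{i | a_i > i}`. -/
def excSet {m : ℕ} (τ : Equiv.Perm (Fin m)) : Finset (Fin m) := {i | i < τ i}

/-- The standardization of a word `w` of length `m`: its smallest letter is replaced by the
smallest element of `Fin m`, its second smallest letter by the second smallest element, and so on.
`Tuple.sort w` sends `j` to the place of the `j`-th smallest letter, so its inverse sends a place
to the rank of the letter at that place. -/
def std {m : ℕ} {α : Type*} [LinearOrder α] (w : Fin m → α) : Equiv.Perm (Fin m) :=
  (Tuple.sort w).symm

/-- The standardization of a word with distinct letters is the permutation in the same relative
order as the word. -/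
theorem std_lt_std_iff {m : ℕ} {α : Type*} [LinearOrder α] (w : Fin m → α)
    (hw : Function.Injective w) (i j : Fin m) : std w i < std w j ↔ w i < w j := by
  have hs : StrictMono (w ∘ Tuple.sort w) :=
    (Tuple.monotone_sort w).strictMono_of_injective (hw.comp (Tuple.sort w).injective)
  have h := hs.lt_iff_lt (a := std w i) (b := std w j)
  simpa [std] using h.symm

/-- The length of the `i`-th block `a_i a_{i+k} a_{i+2k} ⋯` (`i = 0, …, k - 1`): with
`n = d k + r`, `0 ≤ r < k`, it is `d + 1` for the first `r` blocks and `d` for the others. -/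
def blockLen (n k i : ℕ) : ℕ := if i < n % k then n / k + 1 else n / k

theorem block_index_lt {n k i j : ℕ} (hi : i < k) (hj : j < blockLen n k i) :
    i + j * k < n := by
  have hn := Nat.div_add_mod n k
  unfold blockLen at hj
  split_ifs at hj with h
  · have : j * k ≤ k * (n / k) := by
      rw [mul_comm]; exact Nat.mul_le_mul_left k (by omega)
    omega
  · have : (j + 1) * k ≤ k * (n / k) := by
      rw [mul_comm]; exact Nat.mul_le_mul_left k (by omega)
    rw [add_mul] at this
    omega

/-- The `i`-th block of `σ`: the word `a_i a_{i+k} a_{i+2k} ⋯` of all letters of `σ` in the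
positions congruent to `i` modulo `k`. -/
def block {n : ℕ} (k : ℕ) (σ : Equiv.Perm (Fin n)) (i : Fin k) :
    Fin (blockLen n k i) → Fin n :=
  fun j => σ ⟨(i : ℕ) + (j : ℕ) * k, block_index_lt i.isLt j.isLt⟩

/-- The multiset of width-`k` excedances: the multiset union, over the `k` blocks of `σ`, of the
excedance sets of the standardized blocks (as subsets of `{1, 2, …}`). -/
def excMultiset {n : ℕ} (k : ℕ) (σ : Equiv.Perm (Fin n)) : Multiset ℕ :=
  ∑ i : Fin k, (excSet (std (block k σ i))).val.map (fun j => (j : ℕ) + 1)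

/-- The width-`k` excedance number. -/
def exc {n : ℕ} (k : ℕ) (σ : Equiv.Perm (Fin n)) : ℕ := Multiset.card (excMultiset k σ)

end WidthStat

namespace WidthStat

open Polynomial Finset

/-! Each of the four statistics is a sum, over the residue classes modulo `k`, of its width-one
version on the standardized blocks (`des_eq_sum_blocks`, `exc_eq_sum_blocks`, `inv_eq_sum_blocks`,
`maj_eq_sum_blocks`). For uniform `σ` these blocks are independent and uniform
(`sum_prod_std_block`), so `genFun_eq_of_blocks` reduces both claims to `k = 1`.

There, descents and excedances satisfy the same Eulerian recurrence, by inserting the largest letter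
into a word (`sum_des_insertAt`) or a new point into a cycle (`sum_exc_decomposeFin`). For
inversions and the major index, a last letter is appended; the two agree even with that letter
fixed, and this refinement makes the induction work (`sum_maj_insertAt_last`). -/

/-! ### Building permutations by inserting one letter -/

/-- The permutation of `Fin (m + 1)` which sends `p` to `c` and whose other letters are in the
relative order given by `τ`. -/
def insertAt {m : ℕ} (p c : Fin (m + 1)) (τ : Equiv.Perm (Fin m)) : Equiv.Perm (Fin (m + 1)) :=
  ((finSuccEquiv' p).trans (Equiv.optionCongr τ)).trans (finSuccEquiv' c).symm

@[simp]
theorem insertAt_self {m : ℕ} (p c : Fin (m + 1)) (τ : Equiv.Perm (Fin m)) :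
    insertAt p c τ p = c := by
  simp [insertAt]

@[simp]
theorem insertAt_succAbove {m : ℕ} (p c : Fin (m + 1)) (τ : Equiv.Perm (Fin m)) (i : Fin m) :
    insertAt p c τ (p.succAbove i) = c.succAbove (τ i) := by
  simp [insertAt]

@[simp]
theorem insertAt_last_last {m : ℕ} (c : Fin (m + 1)) (τ : Equiv.Perm (Fin m)) :
    insertAt (Fin.last m) c τ (Fin.last m) = c := insertAt_self _ _ _

@[simp]
theorem insertAt_last_castSucc {m : ℕ} (c : Fin (m + 1)) (τ : Equiv.Perm (Fin m)) (i : Fin m) :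
    insertAt (Fin.last m) c τ i.castSucc = c.succAbove (τ i) := by
  simpa using insertAt_succAbove (Fin.last m) c τ i

theorem insertAt_injective {m : ℕ} (p c : Fin (m + 1)) : Function.Injective (insertAt p c) := by
  intro τ τ' h
  ext i
  have h' := DFunLike.congr_fun h (p.succAbove i)
  simp only [insertAt_succAbove] at h'
  rw [Fin.succAbove_right_injective h']

theorem insertAt_value_bijective {m : ℕ} (p : Fin (m + 1)) :
    Function.Bijective fun x : Fin (m + 1) × Equiv.Perm (Fin m) => insertAt p x.1 x.2 := by
  refine (Fintype.bijective_iff_injective_and_card _).2 ⟨?_, ?_⟩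
  · rintro ⟨c, τ⟩ ⟨c', τ'⟩ h
    have hc : c = c' := by simpa using DFunLike.congr_fun h p
    subst hc
    exact congrArg _ (insertAt_injective p c h)
  · simp [Fintype.card_perm, Nat.factorial_succ]

theorem insertAt_position_bijective {m : ℕ} (c : Fin (m + 1)) :
    Function.Bijective fun x : Fin (m + 1) × Equiv.Perm (Fin m) => insertAt x.1 c x.2 := by
  refine (Fintype.bijective_iff_injective_and_card _).2 ⟨?_, ?_⟩
  · rintro ⟨p, τ⟩ ⟨p', τ'⟩ h
    have hp : p = p' := by
      have h' := DFunLike.congr_fun h p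
      simp only [insertAt_self] at h'
      exact (insertAt p' c τ').injective (by simpa using h'.symm)
    subst hp
    exact congrArg _ (insertAt_injective p c h)
  · simp [Fintype.card_perm, Nat.factorial_succ]

theorem sum_perm_eq_sum_insertAt_value {m : ℕ} {M : Type*} [AddCommMonoid M] (p : Fin (m + 1))
    (f : Equiv.Perm (Fin (m + 1)) → M) : ∑ σ, f σ = ∑ c, ∑ τ, f (insertAt p c τ) := by
  rw [← Fintype.sum_prod_type']
  exact ((insertAt_value_bijective p).sum_comp f).symm

theorem sum_perm_eq_sum_insertAt_position {m : ℕ} {M : Type*} [AddCommMonoid M] (c : Fin (m + 1))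
    (f : Equiv.Perm (Fin (m + 1)) → M) : ∑ σ, f σ = ∑ τ, ∑ p, f (insertAt p c τ) := by
  rw [sum_comm, ← Fintype.sum_prod_type']
  exact ((insertAt_position_bijective c).sum_comp f).symm

theorem mem_desSet_one {m : ℕ} (σ : Equiv.Perm (Fin (m + 1))) (i : Fin m) :
    i.castSucc ∈ desSet 1 σ ↔ σ i.succ < σ i.castSucc := by
  simp only [desSet, mem_filter, mem_univ, true_and]
  exact ⟨fun ⟨_, h⟩ => h, fun h => ⟨by simp, h⟩⟩

theorem last_notMem_desSet_one {m : ℕ} (σ : Equiv.Perm (Fin (m + 1))) :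
    Fin.last m ∉ desSet 1 σ := by
  simp [desSet]

theorem sum_desSet_one {m : ℕ} (σ : Equiv.Perm (Fin (m + 1))) (g : Fin (m + 1) → ℕ) :
    ∑ i ∈ desSet 1 σ, g i = ∑ i : Fin m, if σ i.succ < σ i.castSucc then g i.castSucc else 0 := by
  rw [← univ_inter (desSet 1 σ), ← sum_ite_mem, Fin.sum_univ_castSucc]
  simp [mem_desSet_one, last_notMem_desSet_one]

theorem des_one_eq_sum {m : ℕ} (σ : Equiv.Perm (Fin (m + 1))) :
    des 1 σ = ∑ i : Fin m, if σ i.succ < σ i.castSucc then 1 else 0 := by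
  rw [des, card_eq_sum_ones, sum_desSet_one]

theorem maj_one_eq_sum {m : ℕ} (σ : Equiv.Perm (Fin (m + 1))) :
    maj 1 σ = ∑ i : Fin m, if σ i.succ < σ i.castSucc then (i : ℕ) + 1 else 0 := by
  rw [maj, sum_desSet_one]
  simp

/-! ### Descents and excedances -/

/-- The number of descents of the word `w 0, …, w m`. -/
def wordDes (w : ℕ → ℕ) (m : ℕ) : ℕ := ∑ i ∈ range m, if w (i + 1) < w i then 1 else 0

theorem des_one_eq_wordDes {m : ℕ} (σ : Equiv.Perm (Fin (m + 1))) (w : ℕ → ℕ)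
    (h : ∀ i : Fin (m + 1), w i = σ i) : des 1 σ = wordDes w m := by
  rw [des_one_eq_sum, wordDes, ← Fin.sum_univ_eq_sum_range (fun i => if w (i + 1) < w i then 1 else 0)]
  refine sum_congr rfl fun i _ => ?_
  have h1 := h i.succ
  have h2 := h i.castSucc
  simp only [Fin.val_succ, Fin.val_castSucc] at h1 h2
  simp only [h1, h2, Fin.lt_def]

/-- The word `w` with the letter `M` inserted at place `p`. -/
def wordInsert (w : ℕ → ℕ) (p M : ℕ) : ℕ → ℕ :=
  fun i => if i < p then w i else if i = p then M else w (i - 1)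

theorem wordDes_insert_zero (w : ℕ → ℕ) (m M : ℕ) (hM : ∀ i ≤ m, w i < M) :
    wordDes (wordInsert w 0 M) (m + 1) = wordDes w m + 1 := by
  rw [wordDes, sum_range_succ', wordDes]
  simp [wordInsert, hM 0]

theorem wordDes_insert_last (w : ℕ → ℕ) (m M : ℕ) (hM : ∀ i ≤ m, w i < M) :
    wordDes (wordInsert w (m + 1) M) (m + 1) = wordDes w m := by
  rw [wordDes, sum_range_succ, wordDes]
  have : ¬ M < w m := by have := hM m le_rfl; omega
  simp only [wordInsert, lt_add_iff_pos_right, zero_lt_one, if_true, lt_irrefl, if_false, this,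
    add_zero]
  refine sum_congr rfl fun i hi => ?_
  rw [mem_range] at hi
  simp only [show i < m + 1 by omega, hi, add_lt_add_iff_right, if_true]

/-- The adjacent pair at `s`, `s + 1` is replaced by an ascent to `M` followed by a descent from
`M`, so a descent is gained exactly when that pair was not one already. -/
theorem wordDes_insert_middle (w : ℕ → ℕ) (m M s : ℕ) (hs : s < m) (hM : ∀ i ≤ m, w i < M) :
    wordDes (wordInsert w (s + 1) M) (m + 1) =
      if w (s + 1) < w s then wordDes w m else wordDes w m + 1 := by
  obtain ⟨t, rfl⟩ : ∃ t, m = s + 1 + t := ⟨m - (s + 1), by omega⟩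
  have h1 : ¬ M < w s := by have := hM s (by omega); omega
  have h2 : w (s + 1) < M := hM _ (by omega)
  rw [wordDes, wordDes, show s + 1 + t + 1 = s + 1 + 1 + t by ring, sum_range_add, sum_range_succ,
    sum_range_succ, sum_range_add, sum_range_succ]
  have e1 : ∀ i ∈ range s, (if wordInsert w (s + 1) M (i + 1) < wordInsert w (s + 1) M i then 1
      else 0) = if w (i + 1) < w i then 1 else 0 := by
    intro i hi
    rw [mem_range] at hi
    simp only [wordInsert, show i < s + 1 by omega, hi, add_lt_add_iff_right, if_true]
  have e2 : ∀ j ∈ range t, (if wordInsert w (s + 1) M (s + 1 + 1 + j + 1) <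
      wordInsert w (s + 1) M (s + 1 + 1 + j) then 1 else 0) =
      if w (s + 1 + j + 1) < w (s + 1 + j) then 1 else 0 := by
    intro j _
    simp only [wordInsert, show ¬ s + 1 + 1 + j + 1 < s + 1 by omega,
      show ¬ s + 1 + 1 + j < s + 1 by omega, show s + 1 + 1 + j + 1 ≠ s + 1 by omega,
      show s + 1 + 1 + j ≠ s + 1 by omega, if_false,
      show s + 1 + 1 + j + 1 - 1 = s + 1 + j + 1 by omega,
      show s + 1 + 1 + j - 1 = s + 1 + j by omega]
  rw [sum_congr rfl e1, sum_congr rfl e2]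
  have e3 : wordInsert w (s + 1) M s = w s := by simp [wordInsert]
  have e4 : wordInsert w (s + 1) M (s + 1) = M := by simp [wordInsert]
  have e5 : wordInsert w (s + 1) M (s + 1 + 1) = w (s + 1) := by simp [wordInsert]
  rw [e3, e4, e5, if_neg h1, if_pos h2]
  split_ifs <;> ring

theorem des_one_insertAt {m : ℕ} (τ : Equiv.Perm (Fin (m + 1))) :
    des 1 (insertAt 0 (Fin.last _) τ) = des 1 τ + 1 ∧
    des 1 (insertAt (Fin.last _) (Fin.last _) τ) = des 1 τ ∧
    ∀ j : Fin m, des 1 (insertAt j.succ.castSucc (Fin.last _) τ) =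
      if τ j.succ < τ j.castSucc then des 1 τ else des 1 τ + 1 := by
  -- The default `0` is never read: only `w 0, …, w m` enter the descent counts.
  let w : ℕ → ℕ := fun i => if h : i < m + 1 then τ ⟨i, h⟩ else 0
  have hw : ∀ i : Fin (m + 1), w i = τ i := fun i => dif_pos i.isLt
  have hM : ∀ i ≤ m, w i < m + 1 := fun i hi => by
    rw [show w i = τ ⟨i, Nat.lt_succ_of_le hi⟩ from dif_pos _]
    exact Fin.isLt _
  have key : ∀ p : Fin (m + 2), des 1 (insertAt p (Fin.last _) τ) =
      wordDes (wordInsert w p (m + 1)) (m + 1) := by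
    intro p
    refine des_one_eq_wordDes _ _ fun i => ?_
    rcases Fin.eq_self_or_eq_succAbove p i with rfl | ⟨i, rfl⟩
    · simp [wordInsert]
    · rw [insertAt_succAbove, Fin.succAbove_last, Fin.val_castSucc, ← hw]
      rcases lt_or_ge i.castSucc p with h | h
      · rw [Fin.succAbove_of_castSucc_lt _ _ h]
        have h' : (i : ℕ) < p := h
        simp [wordInsert, h']
      · rw [Fin.succAbove_of_le_castSucc _ _ h]
        have h' : (p : ℕ) ≤ i := h
        simp only [wordInsert, Fin.val_succ]
        rw [if_neg (by omega), if_neg (by omega)]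
        simp
  rw [des_one_eq_wordDes τ w hw]
  refine ⟨?_, ?_, fun j => ?_⟩
  · rw [key]; exact wordDes_insert_zero _ _ _ hM
  · rw [key]; exact wordDes_insert_last _ _ _ hM
  · rw [key]
    refine (wordDes_insert_middle _ _ _ j j.isLt hM).trans ?_
    have h1 := hw j.succ
    have h2 := hw j.castSucc
    simp only [Fin.val_succ, Fin.val_castSucc] at h1 h2
    simp only [h1, h2, Fin.lt_def]

theorem sum_ite_const {ι M : Type*} [Fintype ι] [AddCommMonoid M] (P : ι → Prop) [DecidablePred P]
    (a b : M) : ∑ i, (if P i then a else b) =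
      (#{i | P i}) • a + (Fintype.card ι - #{i | P i}) • b := by
  classical
  rw [sum_ite, sum_const, sum_const, filter_not, card_sdiff_of_subset (filter_subset _ _), card_univ]

/-- The Eulerian recurrence: the places that create no descent are the end and the gaps at existing
descents. -/
theorem sum_des_insertAt {M : Type*} [AddCommMonoid M] {m : ℕ} (f : ℕ → M)
    (τ : Equiv.Perm (Fin (m + 1))) :
    ∑ p, f (des 1 (insertAt p (Fin.last _) τ)) =
      (des 1 τ + 1) • f (des 1 τ) + (m + 1 - des 1 τ) • f (des 1 τ + 1) := by
  obtain ⟨h0, hl, hm⟩ := des_one_insertAt τ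
  rw [Fin.sum_univ_castSucc, Fin.sum_univ_succ, Fin.castSucc_zero, h0, hl]
  simp only [hm, apply_ite f]
  rw [sum_ite_const]
  have hd : #{j : Fin m | τ j.succ < τ j.castSucc} = des 1 τ := by
    rw [des_one_eq_sum, card_filter]
  have hle : des 1 τ ≤ m := by
    rw [← hd]; exact (card_le_univ _).trans (by simp)
  rw [hd, Fintype.card_fin, Nat.sub_add_comm hle, add_nsmul, add_nsmul, one_nsmul, one_nsmul]
  abel

theorem exc_decomposeFin_zero {m : ℕ} (e : Equiv.Perm (Fin m)) :
    #(excSet (Equiv.Perm.decomposeFin.symm (0, e))) = #(excSet e) := by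
  rw [excSet, excSet, card_filter, card_filter, Fin.sum_univ_succ]
  simp

/-- The new point `0` enters the cycle of `e` between `j` and `e j`. It is an excedance itself,
while `j.succ`, now sent to `0`, is not one. -/
theorem exc_decomposeFin_succ {m : ℕ} (e : Equiv.Perm (Fin m)) (j : Fin m) :
    #(excSet (Equiv.Perm.decomposeFin.symm ((e j).succ, e))) =
      if j < e j then #(excSet e) else #(excSet e) + 1 := by
  have key : ∀ i : Fin m, (if i.succ < Equiv.Perm.decomposeFin.symm ((e j).succ, e) i.succ
      then 1 else 0) + (if i = j then (if j < e j then 1 else 0) else 0) =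
      if i < e i then 1 else 0 := by
    intro i
    rw [Equiv.Perm.decomposeFin_symm_apply_succ]
    by_cases h : i = j
    · subst h; simp
    · rw [Equiv.swap_apply_of_ne_of_ne (Fin.succ_ne_zero _) (by simpa using h)]
      simp [h]
  have hs := sum_congr (s₁ := univ) rfl fun i _ => key i
  rw [sum_add_distrib, sum_ite_eq' univ j] at hs
  simp only [mem_univ, if_true] at hs
  rw [excSet, excSet, card_filter, card_filter, Fin.sum_univ_succ,
    Equiv.Perm.decomposeFin_symm_apply_zero, if_pos (Fin.succ_pos _), ← hs]
  split_ifs <;> ring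

theorem sum_exc_decomposeFin {M : Type*} [AddCommMonoid M] {m : ℕ} (f : ℕ → M)
    (e : Equiv.Perm (Fin m)) :
    ∑ p, f #(excSet (Equiv.Perm.decomposeFin.symm (p, e))) =
      (#(excSet e) + 1) • f #(excSet e) + (m - #(excSet e)) • f (#(excSet e) + 1) := by
  rw [Fin.sum_univ_succ, exc_decomposeFin_zero,
    ← Equiv.sum_comp e fun i => f #(excSet (Equiv.Perm.decomposeFin.symm (i.succ, e)))]
  simp only [exc_decomposeFin_succ, apply_ite f]
  rw [sum_ite_const, add_nsmul, one_nsmul, Fintype.card_fin]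
  simp only [excSet]
  abel

/-- Descents and excedances are equidistributed. -/
theorem sum_des_one_eq_sum_exc {M : Type*} [AddCommMonoid M] (m : ℕ) (f : ℕ → M) :
    ∑ τ : Equiv.Perm (Fin m), f (des 1 τ) = ∑ τ : Equiv.Perm (Fin m), f #(excSet τ) := by
  induction m generalizing f with
  | zero => simp [des, desSet, excSet]
  | succ m ih =>
    cases m with
    | zero =>
      refine sum_congr rfl fun τ _ => ?_
      rw [des_one_eq_sum, excSet, card_filter]
      have h : τ 0 = 0 := Subsingleton.elim (α := Fin 1) _ _
      simp [filter_singleton, h]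
    | succ m =>
      rw [sum_perm_eq_sum_insertAt_position (Fin.last _),
        ← Equiv.sum_comp Equiv.Perm.decomposeFin.symm fun τ => f #(excSet τ), Fintype.sum_prod_type,
        sum_comm (f := fun p e => f #(excSet (Equiv.Perm.decomposeFin.symm (p, e))))]
      simp only [sum_des_insertAt, sum_exc_decomposeFin]
      -- The recurrence is absorbed into the test function, which is why `f` is arbitrary in the
      -- induction.
      exact ih fun d => (d + 1) • f d + (m + 1 - d) • f (d + 1)

/-! ### Inversions and the major index -/

theorem inv_one_eq_sum {m : ℕ} (σ : Equiv.Perm (Fin m)) :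
    inv 1 σ = ∑ j, ∑ i, if i < j ∧ σ j < σ i then 1 else 0 := by
  rw [inv, invSet, card_filter, Fintype.sum_prod_type, sum_comm]
  simp

theorem inv_insertAt_last {m : ℕ} (c : Fin (m + 1)) (τ : Equiv.Perm (Fin m)) :
    inv 1 (insertAt (Fin.last m) c τ) = inv 1 τ + (m - c) := by
  rw [inv_one_eq_sum, inv_one_eq_sum, Fin.sum_univ_castSucc]
  simp only [Fin.sum_univ_castSucc, insertAt_last_castSucc, insertAt_last_last,
    Fin.castSucc_lt_castSucc_iff, Fin.succAbove_lt_succAbove_iff, Fin.castSucc_lt_last, true_and,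
    lt_irrefl, false_and, if_false, add_zero, (Fin.castSucc_lt_last _).not_gt]
  congr 1
  rw [Equiv.sum_comp τ fun i => if c < c.succAbove i then 1 else 0]
  have h : ∀ i : Fin m, c < c.succAbove i ↔ (c : ℕ) ≤ i := fun i => by
    rw [Fin.lt_succAbove_iff_le_castSucc, Fin.le_def, Fin.val_castSucc]
  simp only [h]
  rw [Fin.sum_univ_eq_sum_range (fun i => if (c : ℕ) ≤ i then 1 else 0) m, ← card_filter,
    show (range m).filter (fun i => (c : ℕ) ≤ i) = Ico (c : ℕ) m by ext; simp [and_comm]]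
  simp

/-- Appending `c` keeps the relative order of the earlier letters, so the only possible new descent
is at the final pair; there `c'` has become `c.succAbove c'`. -/
theorem maj_insertAt_last {m : ℕ} (c : Fin (m + 2)) (c' : Fin (m + 1)) (τ : Equiv.Perm (Fin m)) :
    maj 1 (insertAt (Fin.last (m + 1)) c (insertAt (Fin.last m) c' τ)) =
      maj 1 (insertAt (Fin.last m) c' τ) + if (c : ℕ) ≤ c' then m + 1 else 0 := by
  set σ := insertAt (Fin.last m) c' τ with hσ
  have h : c < c.succAbove c' ↔ (c : ℕ) ≤ c' := by
    rw [Fin.lt_succAbove_iff_le_castSucc, Fin.le_def, Fin.val_castSucc]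
  rw [maj_one_eq_sum, maj_one_eq_sum, Fin.sum_univ_castSucc, Fin.succ_last, insertAt_last_last,
    insertAt_last_castSucc, hσ, insertAt_last_last, ← hσ]
  simp only [Fin.succ_castSucc, insertAt_last_castSucc, Fin.succAbove_lt_succAbove_iff, h,
    Fin.val_castSucc, Fin.val_last]

/-- On the left the exponents run over `b, …, a + b - 1` for `i < a` and over `a + b, …, a + 2b - 1`
for the rest: together, `0, …, a + b - 1` shifted by `b`. -/
theorem sum_ite_pow_reflect {R : Type*} [CommSemiring R] (q : R) (a b : ℕ) :
    ∑ i ∈ range (a + b), q ^ (a + b - 1 - i) * q ^ (if a ≤ i then a + b else 0) =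
      q ^ b * ∑ i ∈ range (a + b), q ^ (a + b - 1 - i) := by
  have h1 : ∑ i ∈ range a, q ^ (a + b - 1 - i) * q ^ (if a ≤ i then a + b else 0) =
      q ^ b * ∑ i ∈ range a, q ^ i := by
    rw [← sum_range_reflect, mul_sum]
    refine sum_congr rfl fun i hi => ?_
    rw [mem_range] at hi
    rw [if_neg (by omega), pow_zero, mul_one, ← pow_add]
    congr 1; omega
  have h2 : ∑ i ∈ range b, q ^ (a + b - 1 - (a + i)) * q ^ (if a ≤ a + i then a + b else 0) =
      q ^ b * ∑ i ∈ range b, q ^ (a + i) := by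
    rw [← sum_range_reflect, mul_sum]
    refine sum_congr rfl fun i hi => ?_
    rw [mem_range] at hi
    rw [if_pos (by omega), ← pow_add, ← pow_add]
    congr 1; omega
  rw [sum_range_add, h1, h2, ← mul_add, ← sum_range_add (fun i => q ^ i),
    sum_range_reflect (fun i => q ^ i)]

theorem sum_maj_insertAt_last (m : ℕ) (c : Fin (m + 1)) :
    ∑ τ : Equiv.Perm (Fin m), (X : ℤ[X]) ^ maj 1 (insertAt (Fin.last m) c τ) =
      X ^ (m - (c : ℕ)) * genFun m (inv 1) := by
  induction m with
  | zero => simp [genFun, maj_one_eq_sum, inv_one_eq_sum]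
  | succ m ih =>
    obtain ⟨b, hb⟩ : ∃ b, m + 1 = c + b := ⟨m + 1 - c, by omega⟩
    -- The summation index is the penultimate letter, ranked among the first `m + 1` letters.
    have key := sum_ite_pow_reflect (X : ℤ[X]) c b
    rw [← hb, Nat.add_sub_cancel, ← Fin.sum_univ_eq_sum_range (fun i => (X : ℤ[X]) ^ (m - i)),
      ← Fin.sum_univ_eq_sum_range (fun i =>
        (X : ℤ[X]) ^ (m - i) * X ^ (if (c : ℕ) ≤ i then m + 1 else 0))] at key
    rw [genFun, sum_perm_eq_sum_insertAt_value (Fin.last m),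
      sum_perm_eq_sum_insertAt_value (Fin.last m)]
    simp only [maj_insertAt_last, inv_insertAt_last, pow_add, ← sum_mul, ih]
    rw [show m + 1 - (c : ℕ) = b by omega]
    simp only [genFun, ← mul_sum]
    rw [mul_left_comm, ← key, mul_sum]
    exact sum_congr rfl fun i _ => by ring

/-- Inversions and the major index are equidistributed. -/
theorem genFun_inv_one_eq_genFun_maj_one (m : ℕ) : genFun m (inv 1) = genFun m (maj 1) := by
  cases m with
  | zero => simp [genFun, inv, invSet, maj, desSet]
  | succ m =>
    conv_rhs => rw [genFun, sum_perm_eq_sum_insertAt_value (Fin.last m)]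
    conv_lhs => rw [genFun, sum_perm_eq_sum_insertAt_value (Fin.last m)]
    refine sum_congr rfl fun c _ => ?_
    rw [sum_maj_insertAt_last, genFun, mul_sum]
    exact sum_congr rfl fun τ _ => by rw [inv_insertAt_last, pow_add, mul_comm]

/-! ### Decomposition into blocks -/

theorem lt_blockLen_iff {n k i j : ℕ} (hi : i < k) : j < blockLen n k i ↔ i + j * k < n := by
  refine ⟨fun hj => block_index_lt hi hj, fun h => ?_⟩
  have hk : 0 < k := by omega
  have hn := Nat.div_add_mod n k
  have hj : j ≤ n / k := (Nat.le_div_iff_mul_le hk).2 (by omega)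
  unfold blockLen
  split_ifs with hr
  · omega
  · refine lt_of_le_of_ne hj fun he => ?_
    rw [he, mul_comm] at h
    omega

/-- The position of the `j`-th letter of the `i`-th block. -/
def blockPos (n k : ℕ) (x : Σ i : Fin k, Fin (blockLen n k i)) : Fin n :=
  ⟨(x.1 : ℕ) + (x.2 : ℕ) * k, block_index_lt x.1.isLt x.2.isLt⟩

theorem blockPos_bijective (n k : ℕ) (hk : 0 < k) : Function.Bijective (blockPos n k) := by
  constructor
  · rintro ⟨i, j⟩ ⟨i', j'⟩ h
    have h' : (i : ℕ) + j * k = i' + j' * k := congrArg Fin.val h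
    have hi : i = i' := by
      have := congrArg (· % k) h'
      simp only [Nat.add_mul_mod_self_right, Nat.mod_eq_of_lt i.isLt,
        Nat.mod_eq_of_lt i'.isLt] at this
      exact Fin.ext this
    subst hi
    have hj : j = j' := Fin.ext (Nat.eq_of_mul_eq_mul_right hk (Nat.add_left_cancel h'))
    rw [hj]
  · intro p
    have hp : (p : ℕ) % k + (p : ℕ) / k * k = p := by rw [mul_comm]; exact Nat.mod_add_div _ _
    refine ⟨⟨⟨p % k, Nat.mod_lt _ hk⟩, ⟨p / k, ?_⟩⟩, Fin.ext hp⟩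
    rw [lt_blockLen_iff (Nat.mod_lt _ hk), hp]
    exact p.isLt

/-- Positions of `σ` correspond to positions in the blocks. -/
noncomputable def blockEquiv (n k : ℕ) (hk : 0 < k) :
    (Σ i : Fin k, Fin (blockLen n k i)) ≃ Fin n :=
  Equiv.ofBijective _ (blockPos_bijective n k hk)

theorem block_injective {n k : ℕ} (hk : 0 < k) (σ : Equiv.Perm (Fin n)) (i : Fin k) :
    Function.Injective (block k σ i) := by
  intro a b h
  have h' := (blockPos_bijective n k hk).1 (a₁ := ⟨i, a⟩) (a₂ := ⟨i, b⟩) (σ.injective h)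
  simpa using h'

theorem perm_eq_of_lt_iff {m : ℕ} (π ρ : Equiv.Perm (Fin m)) (h : ∀ i j, π i < π j ↔ ρ i < ρ j) :
    π = ρ := by
  have hm : StrictMono (π ∘ ρ.symm) := fun a b hab => by
    simpa [h] using hab
  have hid : Set.range (π ∘ ρ.symm) = Set.range (id : Fin m → Fin m) := by
    rw [(π.surjective.comp ρ.symm.surjective).range_eq, Set.range_id]
  have := (hm.range_inj strictMono_id).1 hid
  ext i
  have hi := congrFun this (ρ i)
  simp at hi
  rw [hi]

theorem std_comp {m : ℕ} {α : Type*} [LinearOrder α] (w : Fin m → α) (hw : Function.Injective w)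
    (h : Equiv.Perm (Fin m)) : std (w ∘ h) = std w * h := by
  refine perm_eq_of_lt_iff _ _ fun i j => ?_
  rw [std_lt_std_iff _ (hw.comp h.injective), Equiv.Perm.mul_apply, Equiv.Perm.mul_apply,
    std_lt_std_iff _ hw]
  rfl

/-- The permutation of positions which permutes each block separately. -/
noncomputable def blockPerm {n k : ℕ} (hk : 0 < k)
    (h : ∀ i : Fin k, Equiv.Perm (Fin (blockLen n k i))) : Equiv.Perm (Fin n) :=
  (blockEquiv n k hk).permCongr (Equiv.sigmaCongrRight h)

theorem block_mul_blockPerm {n k : ℕ} (hk : 0 < k) (σ : Equiv.Perm (Fin n))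
    (h : ∀ i : Fin k, Equiv.Perm (Fin (blockLen n k i))) (i : Fin k) :
    block k (σ * blockPerm hk h) i = block k σ i ∘ h i := by
  funext j
  have e : blockPerm hk h (blockEquiv n k hk ⟨i, j⟩) = blockEquiv n k hk ⟨i, h i j⟩ := by
    simp [blockPerm]
  exact congrArg σ e

/-- A statistic that is a product over the standardized blocks: as `σ` varies, the standardized
blocks are independent and uniformly distributed. -/
theorem sum_prod_std_block {n k : ℕ} (hk : 0 < k)
    (g : ∀ i : Fin k, Equiv.Perm (Fin (blockLen n k i)) → ℤ[X]) :
    (Fintype.card (∀ i : Fin k, Equiv.Perm (Fin (blockLen n k i))) : ℤ[X]) *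
      ∑ σ : Equiv.Perm (Fin n), ∏ i, g i (std (block k σ i)) =
      (Fintype.card (Equiv.Perm (Fin n)) : ℤ[X]) * ∏ i, ∑ τ, g i τ := by
  -- Permuting positions inside the blocks is a bijection on the `σ` and multiplies each
  -- standardized block by `h i` on the right. Summing over all `h` then makes the factors
  -- independent.
  have h1 : ∀ h : ∀ i : Fin k, Equiv.Perm (Fin (blockLen n k i)),
      ∑ σ : Equiv.Perm (Fin n), ∏ i, g i (std (block k σ i)) =
      ∑ σ : Equiv.Perm (Fin n), ∏ i, g i (std (block k σ i) * h i) := by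
    intro h
    rw [← Equiv.sum_comp (Equiv.mulRight (blockPerm hk h))]
    refine sum_congr rfl fun σ _ => prod_congr rfl fun i _ => ?_
    rw [Equiv.coe_mulRight, block_mul_blockPerm, std_comp _ (block_injective hk σ i)]
  have h2 : ∀ σ : Equiv.Perm (Fin n),
      ∑ h : ∀ i : Fin k, Equiv.Perm (Fin (blockLen n k i)), ∏ i, g i (std (block k σ i) * h i) =
      ∏ i, ∑ τ, g i τ := by
    intro σ
    rw [← Fintype.prod_sum (fun i τ => g i (std (block k σ i) * τ))]
    exact prod_congr rfl fun i _ => Equiv.sum_comp (Equiv.mulLeft (std (block k σ i))) (g i)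
  rw [← nsmul_eq_mul, ← card_univ, ← sum_const, sum_congr rfl fun h _ => h1 h, sum_comm,
    sum_congr rfl fun σ _ => h2 σ, sum_const, card_univ, nsmul_eq_mul]

theorem genFun_eq_of_blocks {n k : ℕ} (hk : 0 < k) (st st' : Equiv.Perm (Fin n) → ℕ)
    (s s' : ∀ m : ℕ, Equiv.Perm (Fin m) → ℕ)
    (hs : ∀ σ, st σ = ∑ i : Fin k, s _ (std (block k σ i)))
    (hs' : ∀ σ, st' σ = ∑ i : Fin k, s' _ (std (block k σ i)))
    (h : ∀ m, genFun m (s m) = genFun m (s' m)) : genFun n st = genFun n st' := by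
  have hc : (Fintype.card (∀ i : Fin k, Equiv.Perm (Fin (blockLen n k i))) : ℤ[X]) ≠ 0 :=
    Nat.cast_ne_zero.2 Fintype.card_ne_zero
  refine mul_left_cancel₀ hc ?_
  simp only [genFun, hs, hs', ← prod_pow_eq_pow_sum]
  rw [sum_prod_std_block hk fun i τ => X ^ s _ τ, sum_prod_std_block hk fun i τ => X ^ s' _ τ]
  congr 1
  exact prod_congr rfl fun i _ => h _

theorem mem_desSet_blockEquiv {n k : ℕ} (hk : 0 < k) (σ : Equiv.Perm (Fin n)) (i : Fin k)
    (j : Fin (blockLen n k i)) :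
    blockEquiv n k hk ⟨i, j⟩ ∈ desSet k σ ↔ j ∈ desSet 1 (std (block k σ i)) := by
  simp only [desSet, mem_filter, mem_univ, true_and]
  have hp : ((blockEquiv n k hk ⟨i, j⟩ : Fin n) : ℕ) + k = i + (j + 1) * k := by
    change (i : ℕ) + j * k + k = _
    ring
  simp only [hp]
  simp only [std_lt_std_iff _ (block_injective hk σ i)]
  exact ⟨fun ⟨h, h'⟩ => ⟨(lt_blockLen_iff i.isLt).2 h, h'⟩,
    fun ⟨h, h'⟩ => ⟨(lt_blockLen_iff i.isLt).1 h, h'⟩⟩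

theorem sum_desSet_eq_sum_blocks {n k : ℕ} (hk : 0 < k) (σ : Equiv.Perm (Fin n)) (g : Fin n → ℕ) :
    ∑ p ∈ desSet k σ, g p =
      ∑ i : Fin k, ∑ j ∈ desSet 1 (std (block k σ i)), g (blockEquiv n k hk ⟨i, j⟩) := by
  rw [← univ_inter (desSet k σ), ← sum_ite_mem, ← (blockEquiv n k hk).sum_comp, Fintype.sum_sigma]
  refine sum_congr rfl fun i _ => ?_
  simp only [mem_desSet_blockEquiv]
  rw [sum_ite_mem, univ_inter]

theorem des_eq_sum_blocks {n k : ℕ} (hk : 0 < k) (σ : Equiv.Perm (Fin n)) :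
    des k σ = ∑ i : Fin k, des 1 (std (block k σ i)) := by
  simp only [des, card_eq_sum_ones]
  exact sum_desSet_eq_sum_blocks hk σ _

/-- The rounded-up quotient by `k` turns a position of `σ` into the one-based position within its
block. -/
theorem maj_eq_sum_blocks {n k : ℕ} (hk : 0 < k) (σ : Equiv.Perm (Fin n)) :
    maj k σ = ∑ i : Fin k, maj 1 (std (block k σ i)) := by
  rw [maj, sum_desSet_eq_sum_blocks hk]
  refine sum_congr rfl fun i _ => sum_congr rfl fun j _ => ?_
  change ((i : ℕ) + j * k + 1) ⌈/⌉ k = ((j : ℕ) + 1) ⌈/⌉ 1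
  rw [ceilDiv_one, Nat.ceilDiv_eq_add_pred_div,
    show (i : ℕ) + j * k + 1 + k - 1 = i + (j + 1) * k by rw [add_mul]; omega,
    Nat.add_mul_div_right _ _ hk, Nat.div_eq_of_lt i.isLt, zero_add]

theorem exc_eq_sum_blocks {n k : ℕ} (σ : Equiv.Perm (Fin n)) :
    exc k σ = ∑ i : Fin k, #(excSet (std (block k σ i))) := by
  simp [exc, excMultiset]

/-- Two positions differ by a multiple of `k` exactly when they lie in the same block, so no
inversion joins different blocks. -/
theorem mem_invSet_blockEquiv {n k : ℕ} (hk : 0 < k) (σ : Equiv.Perm (Fin n)) (i i' : Fin k)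
    (j : Fin (blockLen n k i)) (j' : Fin (blockLen n k i')) :
    (blockEquiv n k hk ⟨i, j⟩, blockEquiv n k hk ⟨i', j'⟩) ∈ invSet k σ ↔
      ∃ h : i' = i, (j, h ▸ j') ∈ invSet 1 (std (block k σ i)) := by
  have hv : ∀ (i : Fin k) (j : Fin (blockLen n k i)),
      ((blockEquiv n k hk ⟨i, j⟩ : Fin n) : ℕ) = i + j * k := fun _ _ => rfl
  constructor
  · intro h
    simp only [invSet, mem_filter, mem_univ, true_and] at h
    obtain ⟨h1, h2, h3⟩ := h
    have hi : i' = i := by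
      have h4 := (Nat.modEq_iff_dvd' (Fin.lt_def.1 h1).le).2 h2
      simp only [Nat.ModEq, hv, Nat.add_mul_mod_self_right, Nat.mod_eq_of_lt i.isLt,
        Nat.mod_eq_of_lt i'.isLt] at h4
      exact Fin.ext h4.symm
    subst hi
    refine ⟨rfl, ?_⟩
    simp only [invSet, mem_filter, mem_univ, true_and, one_dvd]
    rw [std_lt_std_iff _ (block_injective hk σ i')]
    refine ⟨?_, h3⟩
    rw [Fin.lt_def, hv, hv] at h1
    exact Fin.lt_def.2 (lt_of_mul_lt_mul_right (by omega : (j : ℕ) * k < j' * k) hk.le)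
  · rintro ⟨rfl, h⟩
    simp only [invSet, mem_filter, mem_univ, true_and, one_dvd] at h ⊢
    rw [std_lt_std_iff _ (block_injective hk σ i')] at h
    refine ⟨?_, ?_, h.2⟩
    · rw [Fin.lt_def, hv, hv]
      have := Nat.mul_lt_mul_of_pos_right (Fin.lt_def.1 h.1) hk
      omega
    · rw [hv, hv, Nat.add_sub_add_left, ← Nat.sub_mul]
      exact Dvd.intro_left _ rfl

theorem inv_eq_sum_blocks {n k : ℕ} (hk : 0 < k) (σ : Equiv.Perm (Fin n)) :
    inv k σ = ∑ i : Fin k, inv 1 (std (block k σ i)) := by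
  simp only [inv]
  rw [← card_sigma]
  symm
  refine card_bij (fun x _ => (blockEquiv n k hk ⟨x.1, x.2.1⟩, blockEquiv n k hk ⟨x.1, x.2.2⟩))
    ?_ ?_ ?_
  · rintro ⟨i, j, j'⟩ h
    exact (mem_invSet_blockEquiv hk σ i i j j').2 ⟨rfl, (mem_sigma.1 h).2⟩
  · rintro ⟨i, a, b⟩ _ ⟨i', a', b'⟩ _ h
    obtain ⟨h1, h2⟩ := Prod.mk.inj h
    have h1 := (blockEquiv n k hk).injective h1
    have h2 := (blockEquiv n k hk).injective h2
    obtain rfl : i = i' := congrArg Sigma.fst h1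
    simp only [Sigma.mk.injEq, heq_eq_eq, true_and] at h1 h2
    rw [h1, h2]
  · rintro ⟨p, q⟩ h
    obtain ⟨⟨i, j⟩, rfl⟩ := (blockEquiv n k hk).surjective p
    obtain ⟨⟨i', j'⟩, rfl⟩ := (blockEquiv n k hk).surjective q
    obtain ⟨rfl, h'⟩ := (mem_invSet_blockEquiv hk σ i i' j j').1 h
    exact ⟨⟨i', j, j'⟩, mem_sigma.2 ⟨mem_univ _, h'⟩, rfl⟩

end WidthStat

theorem mainTheorem2 (n k : ℕ) (hn : 0 < n) (hk : 0 < k) :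
    WidthStat.genFun n (WidthStat.des k) = WidthStat.genFun n (WidthStat.exc k) ∧
      WidthStat.genFun n (WidthStat.inv k) = WidthStat.genFun n (WidthStat.maj k) := by
  refine ⟨?_, ?_⟩
  · refine WidthStat.genFun_eq_of_blocks hk _ _ (fun _ => WidthStat.des 1)
      (fun _ τ => (WidthStat.excSet τ).card) (WidthStat.des_eq_sum_blocks hk)
      WidthStat.exc_eq_sum_blocks fun m => ?_
    exact WidthStat.sum_des_one_eq_sum_exc m fun d => Polynomial.X ^ d
  · exact WidthStat.genFun_eq_of_blocks hk _ _ (fun _ => WidthStat.inv 1)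
      (fun _ => WidthStat.maj 1) (WidthStat.inv_eq_sum_blocks hk)
      (WidthStat.maj_eq_sum_blocks hk) WidthStat.genFun_inv_one_eq_genFun_maj_one
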